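/- Let $\ell\ge 1$ and $k\ge 2$ be integers, and let $F(z_1,\dots,z_\ell)$ be a nonzero Laurent polynomial in $\ell$ variables with complex coefficients that is the sum of $k$ monomials $c\,z_1^{j_1}\cdots z_\ell^{j_\ell}$ with $c\in\mathbb{C}$ and $(j_1,\dots,j_\ell)\in\mathbb{Z}^\ell$ (some of the coefficients $c$ may be $0$). Let $h(F)$ denote the height of $F$, that is, the maximum modulus of its coefficients, and let $M(F)=\exp(m(F))$ be its Mahler measure, where \[ m(F)=\int_0^1\cdots\int_0^1\log\left|F(e^{2\pi i t_1},\dots,e^{2\pi i t_\ell})\right|\,dt_1\cdots dt_\ell . \] Then this integral converges absolutely, and \[ M(F)\ \ge\ \frac{h(F)}{2^{k-2}} . \] -/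

import Mathlib

/-- Laurent polynomials with complex coefficients in the `ℓ` variables `z₁, …, z_ℓ`: finite sums
`∑ c(j) z^j` with exponent vectors `j ∈ ℤ^ℓ`. -/
abbrev MvLaurentPolynomial (ℓ : ℕ) : Type :=
  AddMonoidAlgebra ℂ (Fin ℓ → ℤ)

namespace MvLaurentPolynomial

/-- The monomial `c z₁^{j₁} ⋯ z_ℓ^{j_ℓ}`. -/
noncomputable def monomial {ℓ : ℕ} (j : Fin ℓ → ℤ) (c : ℂ) : MvLaurentPolynomial ℓ :=
  AddMonoidAlgebra.single j c

/-- `F` is the sum of `k` monomials. Coefficients may vanish and exponents may repeat. -/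
def IsSumOfMonomials {ℓ : ℕ} (F : MvLaurentPolynomial ℓ) (k : ℕ) : Prop :=
  ∃ (e : Fin k → Fin ℓ → ℤ) (c : Fin k → ℂ), F = ∑ i, monomial (e i) (c i)

/-- The value `F(z₁, …, z_ℓ)` (used at points with nonzero coordinates). -/
noncomputable def eval {ℓ : ℕ} (z : Fin ℓ → ℂ) (F : MvLaurentPolynomial ℓ) : ℂ :=
  F.coeff.sum fun j c => c * ∏ i, z i ^ j i

/-- The height `h(F)`: the maximum modulus of the coefficients of `F`. -/
noncomputable def height {ℓ : ℕ} (F : MvLaurentPolynomial ℓ) : ℝ :=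
  ((F.coeff.support.sup fun j => ‖F.coeff j‖₊ : NNReal) : ℝ)

/-- The function `(t₁, …, t_ℓ) ↦ log |F(e^{2πi t₁}, …, e^{2πi t_ℓ})|`. -/
noncomputable def logNormOnTorus {ℓ : ℕ} (F : MvLaurentPolynomial ℓ) (t : Fin ℓ → ℝ) : ℝ :=
  Real.log ‖F.eval fun i => Complex.exp (2 * Real.pi * Complex.I * t i)‖

/-- The logarithmic Mahler measure `m(F)`: the integral over the unit cube `[0,1]^ℓ` of
`log |F(e^{2πi t₁}, …, e^{2πi t_ℓ})|`. -/
noncomputable def logMahlerMeasure {ℓ : ℕ} (F : MvLaurentPolynomial ℓ) : ℝ :=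
  ∫ t in Set.Icc (0 : Fin ℓ → ℝ) 1, F.logNormOnTorus t

/-- The Mahler measure `M(F) = exp (m(F))` (of a nonzero `F`). -/
noncomputable def mahlerMeasure {ℓ : ℕ} (F : MvLaurentPolynomial ℓ) : ℝ :=
  Real.exp F.logMahlerMeasure

end MvLaurentPolynomial

/-! In one variable, each term beyond the second costs a factor 2. Once a power of `X` is removed,
differentiation kills the constant term, and M(p') ≤ d M(p) with d = deg p, so induction bounds
n|a_n|. The conjugate reciprocal polynomial has the same Mahler measure and gives the same bound for
(d - n)|a_n|; adding the two and dividing by d gives the factor 2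
(`norm_coeff_le_two_pow_mul_mahlerMeasure`). The derivative bound (`mahlerMeasure_derivative_le`)
compares p, via Gauss–Lucas, with the polynomial whose roots outside the disc are reflected into it.

In several variables, F is restricted to translates of a line on the torus whose integral direction
separates the exponents. Up to a unimodular factor each restriction is a one-variable polynomial
whose coefficients have the same moduli as those of F, so one bound serves all translates. Averaging
b - log|F| ≥ 0 over the translates by Tonelli yields both integrability and the lower bound
(`lintegral_torus_le`). -/

namespace Polynomial

open Filter Topology MeasureTheory

/-! ### Mahler measure of a derivative -/

/-- The Mahler measure is monotone in the absolute value on the unit circle. -/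
theorem mahlerMeasure_mono {p q : ℂ[X]} (hq : q ≠ 0)
    (h : ∀ z : ℂ, ‖z‖ = 1 → ‖p.eval z‖ ≤ ‖q.eval z‖) :
    p.mahlerMeasure ≤ q.mahlerMeasure := by
  by_cases hp : p = 0
  · simpa [hp] using q.mahlerMeasure_nonneg
  rw [mahlerMeasure_def_of_ne_zero hp, mahlerMeasure_def_of_ne_zero hq]
  refine Real.exp_le_exp.mpr (mul_le_mul_of_nonneg_left ?_ (by positivity))
  refine intervalIntegral.integral_mono_ae (by positivity) p.intervalIntegrable_mahlerMeasure
    q.intervalIntegrable_mahlerMeasure ?_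
  -- Zeros of p are discarded: there `Real.log 0 = 0` may exceed log|q|.
  have hc : {θ : ℝ | p.eval (circleMap 0 1 θ) = 0}.Countable := by
    have := (p.roots.toFinset.countable_toSet).preimage_circleMap (0 : ℂ) one_ne_zero
    refine this.mono fun θ hθ => ?_
    simpa [hp] using hθ
  filter_upwards [hc.ae_notMem volume] with θ hθ
  exact Real.log_le_log (norm_pos_iff.mpr hθ) (h _ (by simp))

theorem mahlerMeasure_congr {p q : ℂ[X]} (h : ∀ z : ℂ, ‖z‖ = 1 → ‖p.eval z‖ = ‖q.eval z‖)
    (hp : p ≠ 0) (hq : q ≠ 0) : p.mahlerMeasure = q.mahlerMeasure :=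
  le_antisymm (mahlerMeasure_mono hq fun z hz => (h z hz).le)
    (mahlerMeasure_mono hp fun z hz => (h z hz).ge)

/-- A polynomial without zeros outside the closed unit disc has no critical points there either. -/
theorem eval_derivative_ne_zero_of_one_lt_norm {P : ℂ[X]} (hP : 0 < P.degree)
    (h : ∀ z : ℂ, 1 < ‖z‖ → P.eval z ≠ 0) {z : ℂ} (hz : 1 < ‖z‖) :
    P.derivative.eval z ≠ 0 := by
  intro h0
  have hd : P.derivative ≠ 0 := by
    intro h1
    exact (natDegree_pos_iff_degree_pos.mpr hP).ne' (derivative_eq_zero.mp h1)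
  have hmem : z ∈ P.derivative.rootSet ℂ := by simp [mem_rootSet, hd, h0]
  have hsub : convexHull ℝ (P.rootSet ℂ) ⊆ Metric.closedBall 0 1 := by
    refine convexHull_min (fun w hw => ?_) (convex_closedBall _ _)
    rw [mem_rootSet] at hw
    by_contra hw1
    exact h w (by simpa using hw1) (by simpa using hw.2)
  have := hsub (rootSet_derivative_subset_convexHull_rootSet hP hmem)
  rw [mem_closedBall_zero_iff] at this
  linarith

theorem mahlerMeasure_eq_norm_leadingCoeff {P : ℂ[X]} (h : ∀ z : ℂ, 1 < ‖z‖ → P.eval z ≠ 0) :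
    P.mahlerMeasure = ‖P.leadingCoeff‖ := by
  rw [mahlerMeasure_eq_leadingCoeff_mul_prod_roots, Multiset.prod_eq_one, mul_one]
  intro x hx
  obtain ⟨a, ha, rfl⟩ := Multiset.mem_map.mp hx
  refine max_eq_left (not_lt.mp fun h1 => h a h1 (isRoot_of_mem_roots ha))

/-- De Bruijn's comparison of derivatives. -/
theorem norm_eval_derivative_le {p q : ℂ[X]} (hdeg : p.natDegree ≤ q.natDegree)
    (hq0 : 0 < q.natDegree) (hlead : ‖p.coeff q.natDegree‖ ≤ ‖q.leadingCoeff‖)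
    (hq : ∀ z : ℂ, 1 < ‖z‖ → q.eval z ≠ 0)
    (h : ∀ z : ℂ, 1 < ‖z‖ → ‖p.eval z‖ ≤ ‖q.eval z‖) {z : ℂ} (hz : 1 < ‖z‖) :
    ‖p.derivative.eval z‖ ≤ ‖q.derivative.eval z‖ := by
  by_contra! hlt
  have hq' : q.derivative.eval z ≠ 0 :=
    eval_derivative_ne_zero_of_one_lt_norm (natDegree_pos_iff_degree_pos.mp hq0) hq hz
  -- Since |c| > 1, p - c q has no zeros outside the closed disc, yet z is a critical point of it,
  -- against Gauss–Lucas.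
  set c : ℂ := p.derivative.eval z / q.derivative.eval z with hc
  have hc1 : 1 < ‖c‖ := by
    rw [hc, norm_div]
    exact (one_lt_div (norm_pos_iff.mpr hq')).mpr hlt
  have aux : ∀ a b : ℂ, b ≠ 0 → ‖a‖ ≤ ‖b‖ → a - c * b ≠ 0 := by
    intro a b hb hab h0
    have h1 : ‖a‖ = ‖c‖ * ‖b‖ := by rw [sub_eq_zero.mp h0, norm_mul]
    have := norm_pos_iff.mpr hb
    nlinarith
  -- This coefficient does not cancel, so p - c q is nonconstant.
  have hcoeff : (p - C c * q).coeff q.natDegree ≠ 0 := by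
    rw [coeff_sub, coeff_C_mul]
    refine aux _ _ ?_ hlead
    exact leadingCoeff_ne_zero.mpr (by rintro rfl; simp at hq0)
  refine eval_derivative_ne_zero_of_one_lt_norm (P := p - C c * q) ?_ ?_ hz ?_
  · rw [← natDegree_pos_iff_degree_pos]
    exact hq0.trans_le (le_natDegree_of_ne_zero hcoeff)
  · intro w hw
    rw [eval_sub, eval_mul, eval_C]
    exact aux _ _ (hq w hw) (h w hw)
  · simp [hc, hq']

/-- The linear factor with root reflected into the closed unit disc. -/
noncomputable def reflectedFactor (a : ℂ) : ℂ[X] :=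
  if ‖a‖ ≤ 1 then X - C a else C (-(starRingEnd ℂ a)) * X + C 1

theorem reflectedFactor_natDegree_leadingCoeff (a : ℂ) :
    (reflectedFactor a).natDegree = 1 ∧ ‖(reflectedFactor a).leadingCoeff‖ = max 1 ‖a‖ := by
  unfold reflectedFactor
  split_ifs with h
  · simp [h]
  · have ha : -(starRingEnd ℂ a) ≠ 0 := by
      rw [neg_ne_zero]
      intro h0
      simp [(_root_.map_eq_zero _).mp h0] at h
    rw [natDegree_linear ha, leadingCoeff_linear ha]
    simp [(not_le.mp h).le]

/-- For |a| > 1 this rests on |1 - conj(a) z|² - |z - a|² = (|z|² - 1)(|a|² - 1). -/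
theorem norm_sub_le_norm_eval_reflectedFactor (a : ℂ) {z : ℂ} (hz : 1 < ‖z‖) :
    ‖z - a‖ ≤ ‖(reflectedFactor a).eval z‖ ∧ (reflectedFactor a).eval z ≠ 0 := by
  unfold reflectedFactor
  split_ifs with h
  · refine ⟨by simp, ?_⟩
    simp only [eval_sub, eval_X, eval_C]
    intro h0
    rw [sub_eq_zero.mp h0] at hz
    linarith
  · simp only [eval_add, eval_mul, eval_X, eval_C]
    have ha := not_le.mp h
    constructor
    · rw [← sq_le_sq₀ (norm_nonneg _) (norm_nonneg _), ← Complex.normSq_eq_norm_sq,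
        ← Complex.normSq_eq_norm_sq]
      have h1 : 1 ≤ Complex.normSq z := by rw [Complex.normSq_eq_norm_sq]; nlinarith
      have h2 : 1 ≤ Complex.normSq a := by rw [Complex.normSq_eq_norm_sq]; nlinarith
      rw [Complex.normSq_apply] at *
      simp only [Complex.normSq_apply, Complex.sub_re, Complex.sub_im, Complex.add_re,
        Complex.add_im, Complex.mul_re, Complex.mul_im, Complex.neg_re, Complex.neg_im,
        Complex.conj_re, Complex.conj_im, Complex.one_re, Complex.one_im] at *
      nlinarith [mul_nonneg (sub_nonneg.mpr h1) (sub_nonneg.mpr h2)]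
    · intro h0
      have h1 : starRingEnd ℂ a * z = 1 := by linear_combination -h0
      have h2 := congrArg norm h1
      rw [norm_mul, RCLike.norm_conj, norm_one] at h2
      nlinarith

/-- The derivative of a polynomial `p` satisfies `M(p') ≤ deg p · M(p)`. -/
theorem mahlerMeasure_derivative_le (p : ℂ[X]) :
    p.derivative.mahlerMeasure ≤ p.natDegree * p.mahlerMeasure := by
  rcases Nat.eq_zero_or_pos p.natDegree with hd | hd
  · simp [derivative_of_natDegree_zero hd, hd]
  have hp : p ≠ 0 := by rintro rfl; simp at hd
  -- q dominates p outside the disc and |lead q| = M(p). As q' has all its roots in the closed disc,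
  -- M(q') = |lead q'| = d M(p).
  set q : ℂ[X] := C p.leadingCoeff * (p.roots.map reflectedFactor).prod with hqdef
  have hlc : p.leadingCoeff ≠ 0 := leadingCoeff_ne_zero.mpr hp
  have hfac : ∀ f ∈ p.roots.map reflectedFactor, f ≠ 0 := by
    intro f hf h0
    obtain ⟨a, -, rfl⟩ := Multiset.mem_map.mp hf
    have := (reflectedFactor_natDegree_leadingCoeff a).1
    simp [h0] at this
  have hqdeg : q.natDegree = p.natDegree := by
    rw [hqdef, natDegree_C_mul hlc, natDegree_multiset_prod _ (fun h => hfac 0 h rfl),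
      Multiset.map_map]
    simp only [Function.comp_def, (reflectedFactor_natDegree_leadingCoeff _).1]
    simp [(IsAlgClosed.splits p).natDegree_eq_card_roots]
  have hqlead : ‖q.leadingCoeff‖ = p.mahlerMeasure := by
    rw [hqdef, leadingCoeff_mul, leadingCoeff_C, leadingCoeff_multiset_prod, norm_mul,
      mahlerMeasure_eq_leadingCoeff_mul_prod_roots, Multiset.map_map]
    congr 1
    change (normHom : ℂ →*₀ ℝ) _ = _
    rw [map_multiset_prod, Multiset.map_map]
    congr 1
    exact Multiset.map_congr rfl fun a _ => (reflectedFactor_natDegree_leadingCoeff a).2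
  have key : ∀ z : ℂ, 1 < ‖z‖ → ‖p.eval z‖ ≤ ‖q.eval z‖ ∧ q.eval z ≠ 0 := by
    intro z hz
    have hpe : p.eval z = p.leadingCoeff * (p.roots.map fun a => z - a).prod := by
      conv_lhs => rw [(IsAlgClosed.splits p).eq_prod_roots]
      simp [eval_multiset_prod, Multiset.map_map]
    have hqe : q.eval z =
        p.leadingCoeff * (p.roots.map fun a => (reflectedFactor a).eval z).prod := by
      simp [hqdef, eval_multiset_prod, Multiset.map_map]
    rw [hpe, hqe, norm_mul, norm_mul]
    have : ∀ s : Multiset ℂ, ‖(s.map fun a => z - a).prod‖ ≤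
        ‖(s.map fun a => (reflectedFactor a).eval z).prod‖ ∧
        (s.map fun a => (reflectedFactor a).eval z).prod ≠ 0 := by
      intro s
      induction s using Multiset.induction_on with
      | empty => simp
      | cons a s ih =>
        obtain ⟨h1, h2⟩ := norm_sub_le_norm_eval_reflectedFactor a hz
        simp only [Multiset.map_cons, Multiset.prod_cons, norm_mul]
        exact ⟨mul_le_mul h1 ih.1 (norm_nonneg _) (norm_nonneg _), mul_ne_zero h2 ih.2⟩
    exact ⟨mul_le_mul_of_nonneg_left (this _).1 (norm_nonneg _), mul_ne_zero hlc (this _).2⟩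
  have hqd : 0 < q.natDegree := hqdeg ▸ hd
  have hq'0 : ∀ z : ℂ, 1 < ‖z‖ → q.derivative.eval z ≠ 0 := fun z hz =>
    eval_derivative_ne_zero_of_one_lt_norm (natDegree_pos_iff_degree_pos.mp hqd)
      (fun w hw => (key w hw).2) hz
  have hout : ∀ z : ℂ, 1 < ‖z‖ → ‖p.derivative.eval z‖ ≤ ‖q.derivative.eval z‖ := fun z hz =>
    norm_eval_derivative_le hqdeg.ge hqd
      (by rw [hqdeg, hqlead]; exact leadingCoeff_le_mahlerMeasure p)
      (fun w hw => (key w hw).2) (fun w hw => (key w hw).1) hz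
  -- Limit along the ray r z as r decreases to 1.
  have hcirc : ∀ z : ℂ, ‖z‖ = 1 → ‖p.derivative.eval z‖ ≤ ‖q.derivative.eval z‖ := by
    intro z hz
    have hcont : ∀ f : ℂ[X], Tendsto (fun r : ℝ => ‖f.eval (r * z)‖) (𝓝[>] 1) (𝓝 ‖f.eval z‖) := by
      intro f
      have : Continuous fun r : ℝ => ‖f.eval (r * z)‖ := by fun_prop
      simpa using (this.tendsto 1).mono_left nhdsWithin_le_nhds
    refine le_of_tendsto_of_tendsto (hcont _) (hcont _) ?_
    filter_upwards [self_mem_nhdsWithin] with r hr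
    refine hout _ ?_
    have hr1 : (1 : ℝ) < r := hr
    rw [norm_mul, hz, mul_one, Complex.norm_real, Real.norm_eq_abs]
    exact hr1.trans_le (le_abs_self r)
  have hqne : q.derivative ≠ 0 := by
    intro h0
    exact hq'0 2 (by norm_num) (by simp [h0])
  refine (mahlerMeasure_mono hqne hcirc).trans ?_
  rw [mahlerMeasure_eq_norm_leadingCoeff hq'0, leadingCoeff_derivative, hqdeg]
  simp [hqlead, mul_comm]

/-! ### Coefficients of sparse polynomials in one variable -/

theorem mahlerMeasure_X_pow_mul (m : ℕ) (q : ℂ[X]) :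
    (X ^ m * q).mahlerMeasure = q.mahlerMeasure := by
  have hX : (X : ℂ[X]).mahlerMeasure = 1 := by simpa using mahlerMeasure_X_sub_C 0
  induction m with
  | zero => simp
  | succ m ih => rw [pow_succ', mul_assoc, mahlerMeasure_mul, hX, ih, one_mul]

theorem norm_coeff_zero_le_mahlerMeasure (p : ℂ[X]) : ‖p.coeff 0‖ ≤ p.mahlerMeasure := by
  simpa using norm_coeff_le_choose_mul_mahlerMeasure 0 p

/-- On the unit circle 1/z = conj z, so both polynomials have the same modulus at each point;
without conjugation the moduli would match only at conjugate points. -/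
theorem mahlerMeasure_reverse_map_conj {p : ℂ[X]} (hp : p ≠ 0) :
    (p.map (starRingEnd ℂ)).reverse.mahlerMeasure = p.mahlerMeasure := by
  have hmap : p.map (starRingEnd ℂ) ≠ 0 := by simpa using hp
  refine mahlerMeasure_congr (fun z hz => ?_) (by simpa using hp) hp
  have hz0 : z ≠ 0 := by rintro rfl; simp at hz
  have hinv : z⁻¹ = starRingEnd ℂ z := Complex.inv_eq_conj hz
  have hzz : starRingEnd ℂ z ≠ 0 := by simpa using hz0
  let := invertibleOfNonzero hzz
  have h := eval₂_reverse_mul_pow (RingHom.id ℂ) (starRingEnd ℂ z) (p.map (starRingEnd ℂ))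
  have hi : ⅟(starRingEnd ℂ z) = z := by
    rw [invOf_eq_inv, ← hinv, inv_inv]
  rw [hi] at h
  simp only [eval₂_id, eval_map] at h
  have h2 := congrArg norm h
  rw [norm_mul, norm_pow, RCLike.norm_conj, hz, one_pow, mul_one] at h2
  rw [h2, eval₂_hom, RCLike.norm_conj]

theorem card_support_derivative_lt {p : ℂ[X]} (h : p.coeff 0 ≠ 0) :
    p.derivative.support.card < p.support.card := by
  have h0 : 0 ∈ p.support := mem_support_iff.mpr h
  have hle : p.derivative.support.card ≤ (p.support.erase 0).card := by
    refine Finset.card_le_card_of_injOn (· + 1) (fun n hn => ?_) (fun a _ b _ => by simp)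
    have hn' := mem_support_iff.mp hn
    rw [coeff_derivative] at hn'
    simpa using left_ne_zero_of_mul hn'
  rw [Finset.card_erase_of_mem h0] at hle
  have := Finset.card_pos.mpr ⟨0, h0⟩
  omega

theorem card_support_reverse_map_conj_le (p : ℂ[X]) :
    (p.map (starRingEnd ℂ)).reverse.support.card ≤ p.support.card := by
  rw [show (p.map (starRingEnd ℂ)).reverse = reflect _ (p.map (starRingEnd ℂ)) from rfl,
    reflect_support]
  exact Finset.card_image_le.trans (Finset.card_le_card (support_map_subset _ _))

/-- A polynomial with at most `k + 2` nonzero coefficients has height at most `2 ^ k` times its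
Mahler measure. -/
theorem norm_coeff_le_two_pow_mul_mahlerMeasure (k : ℕ) (p : ℂ[X]) (hcard : p.support.card ≤ k + 2)
    (n : ℕ) : ‖p.coeff n‖ ≤ 2 ^ k * p.mahlerMeasure := by
  have shift : ∀ k : ℕ, (∀ q : ℂ[X], q.coeff 0 ≠ 0 → q.support.card ≤ k + 2 →
      ∀ n, ‖q.coeff n‖ ≤ 2 ^ k * q.mahlerMeasure) → ∀ p : ℂ[X], p.support.card ≤ k + 2 →
      ∀ n, ‖p.coeff n‖ ≤ 2 ^ k * p.mahlerMeasure := by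
    intro k hq p hp n
    by_cases hp0 : p = 0
    · simp [hp0]
    obtain ⟨q, hpq, hq0⟩ := exists_eq_pow_rootMultiplicity_mul_and_not_dvd p hp0 0
    rw [C_0, sub_zero] at hpq hq0
    set m := p.rootMultiplicity 0
    have hq0' : q.coeff 0 ≠ 0 := fun h => hq0 (X_dvd_iff.mpr h)
    have hqc : q.support.card ≤ p.support.card := by
      refine Finset.card_le_card_of_injOn (· + m) (fun i hi => ?_) (fun a _ b _ => by simp)
      have := mem_support_iff.mp hi
      simpa [hpq, coeff_X_pow_mul] using this
    rw [hpq, mahlerMeasure_X_pow_mul, coeff_X_pow_mul']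
    split_ifs
    · exact hq q hq0' (hqc.trans hp) _
    · rw [norm_zero]
      exact mul_nonneg (by positivity) q.mahlerMeasure_nonneg
  induction k generalizing p n with
  | zero =>
    refine shift 0 (fun q hq0 hqc n => ?_) p hcard n
    rw [pow_zero, one_mul]
    by_cases hn : q.coeff n = 0
    · simpa [hn] using q.mahlerMeasure_nonneg
    rcases eq_or_ne n 0 with rfl | hn0
    · exact norm_coeff_zero_le_mahlerMeasure q
    have hqne : q ≠ 0 := by rintro rfl; simp at hq0
    -- Otherwise 0, n and the degree would be three exponents in the support.
    have hnd : n = q.natDegree := by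
      by_contra hne
      have h3 : ({0, n, q.natDegree} : Finset ℕ) ⊆ q.support := by
        intro i hi
        simp only [Finset.mem_insert, Finset.mem_singleton] at hi
        rcases hi with rfl | rfl | rfl <;> simp [*]
      have h4 := Finset.card_le_card h3
      have hle := le_natDegree_of_ne_zero hn
      rw [Finset.card_eq_three.mpr ⟨0, n, q.natDegree, hn0.symm, by omega, hne, rfl⟩] at h4
      omega
    rw [hnd]
    exact leadingCoeff_le_mahlerMeasure q
  | succ k ih =>
    refine shift (k + 1) (fun q hq0 hqc n => ?_) p hcard n
    have hqne : q ≠ 0 := by rintro rfl; simp at hq0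
    by_cases hn : q.coeff n = 0
    · rw [hn, norm_zero]
      exact mul_nonneg (by positivity) q.mahlerMeasure_nonneg
    have hnd : n ≤ q.natDegree := le_natDegree_of_ne_zero hn
    have step : ∀ r : ℂ[X], r.coeff 0 ≠ 0 → r.support.card ≤ k + 3 → ∀ i : ℕ,
        (i : ℝ) * ‖r.coeff i‖ ≤ 2 ^ k * (r.natDegree * r.mahlerMeasure) := by
      intro r hr0 hrc i
      cases i with
      | zero =>
        rw [Nat.cast_zero, zero_mul]
        exact mul_nonneg (by positivity)
          (mul_nonneg (Nat.cast_nonneg _) r.mahlerMeasure_nonneg)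
      | succ i =>
        have h1 := ih r.derivative (by have := card_support_derivative_lt hr0; omega) i
        rw [coeff_derivative, norm_mul] at h1
        have h2 : ‖((i : ℂ) + 1)‖ = ((i + 1 : ℕ) : ℝ) := by
          rw [← Nat.cast_succ, Complex.norm_natCast]
        rw [h2, mul_comm] at h1
        exact h1.trans (mul_le_mul_of_nonneg_left (mahlerMeasure_derivative_le r) (by positivity))
    have hdm : (q.map (starRingEnd ℂ)).natDegree = q.natDegree := natDegree_map _
    have hrev0 : (q.map (starRingEnd ℂ)).reverse.coeff 0 ≠ 0 := by
      rw [coeff_zero_reverse]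
      simpa using hqne
    have hrevd : (q.map (starRingEnd ℂ)).reverse.natDegree = q.natDegree := by
      rw [reverse_natDegree, natTrailingDegree_eq_zero_of_constantCoeff_ne_zero, hdm, Nat.sub_zero]
      simpa using hq0
    -- Reversal moves index n to d - n, so `h1` and `h2` add up to d|a_n| ≤ 2 · 2^k · d M(q).
    have h1 := step q hq0 hqc n
    have h2 := step _ hrev0 ((card_support_reverse_map_conj_le q).trans hqc) (q.natDegree - n)
    rw [hrevd, mahlerMeasure_reverse_map_conj hqne, coeff_reverse, hdm,
      revAt_le (Nat.sub_le _ _), Nat.sub_sub_self hnd, coeff_map, RCLike.norm_conj,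
      Nat.cast_sub hnd] at h2
    rcases Nat.eq_zero_or_pos q.natDegree with hd | hd
    · have hn0 : n = 0 := by omega
      rw [hn0]
      refine (norm_coeff_zero_le_mahlerMeasure q).trans ?_
      exact le_mul_of_one_le_left q.mahlerMeasure_nonneg (one_le_pow₀ one_le_two)
    · have hd' : (0 : ℝ) < q.natDegree := Nat.cast_pos.mpr hd
      refine le_of_mul_le_mul_left ?_ hd'
      rw [pow_succ]
      nlinarith

end Polynomial

/-! ### Separating exponents, and lines on the torus -/

/-- Finitely many integer vectors are separated by an integral linear form. -/
theorem exists_injOn_sum_mul {ℓ : ℕ} (S : Finset (Fin ℓ → ℤ)) :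
    ∃ a : Fin ℓ → ℤ, Set.InjOn (fun j : Fin ℓ → ℤ => ∑ i, a i * j i) S := by
  classical
  let P : (Fin ℓ → ℤ) → Polynomial ℤ := fun v =>
    ∑ i : Fin ℓ, Polynomial.monomial (i : ℕ) (v i)
  have hP : ∀ v : Fin ℓ → ℤ, v ≠ 0 → P v ≠ 0 := by
    intro v hv h0
    apply hv
    ext i
    have := congrArg (fun p => Polynomial.coeff p (i : ℕ)) h0
    simpa [P, Polynomial.finsetSum_coeff, Polynomial.coeff_monomial, Fin.val_inj] using this
  -- With a_i = t^i, the form takes the value P_v(t) at v, so t need only avoid the roots of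
  -- finitely many nonzero polynomials.
  obtain ⟨t, ht⟩ := Infinite.exists_notMem_finset
    ((S ×ˢ S).biUnion fun x => (P (x.1 - x.2)).roots.toFinset)
  refine ⟨fun i => t ^ (i : ℕ), fun x hx y hy hxy => ?_⟩
  by_contra hne
  apply ht
  rw [Finset.mem_biUnion]
  refine ⟨(x, y), Finset.mem_product.mpr ⟨hx, hy⟩, ?_⟩
  rw [Multiset.mem_toFinset, Polynomial.mem_roots (hP _ (sub_ne_zero.mpr hne))]
  simp only [P, Polynomial.IsRoot, Polynomial.eval_finsetSum, Polynomial.eval_monomial,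
    Pi.sub_apply, sub_mul, Finset.sum_sub_distrib]
  simp only [mul_comm _ (t ^ _)]
  exact sub_eq_zero.mpr hxy

namespace MvLaurentPolynomial

open MeasureTheory Polynomial

variable {ℓ : ℕ}

/-- A Laurent polynomial as a trigonometric polynomial on the torus `(ℝ / ℤ) ^ ℓ`. -/
noncomputable def torusEval (F : MvLaurentPolynomial ℓ) (x : UnitAddTorus (Fin ℓ)) : ℂ :=
  ∑ j ∈ F.coeff.support, F.coeff j * UnitAddTorus.mFourier j x

theorem continuous_torusEval (F : MvLaurentPolynomial ℓ) : Continuous F.torusEval := by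
  unfold torusEval
  fun_prop

theorem norm_mFourier_apply (j : Fin ℓ → ℤ) (x : UnitAddTorus (Fin ℓ)) :
    ‖UnitAddTorus.mFourier j x‖ = 1 := by
  rw [UnitAddTorus.mFourier, ContinuousMap.coe_mk, norm_prod]
  exact Finset.prod_eq_one fun i _ => Circle.norm_coe _

theorem logNormOnTorus_eq (F : MvLaurentPolynomial ℓ) (t : Fin ℓ → ℝ) :
    F.logNormOnTorus t = Real.log ‖F.torusEval fun i => (t i : UnitAddCircle)‖ := by
  unfold logNormOnTorus eval torusEval Finsupp.sum
  congr 2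
  refine Finset.sum_congr rfl fun j _ => ?_
  dsimp only
  rw [UnitAddTorus.mFourier, ContinuousMap.coe_mk]
  refine congrArg _ (Finset.prod_congr rfl fun i _ => ?_)
  rw [fourier_coe_apply, ← Complex.exp_int_mul]
  congr 1
  push_cast
  ring

/-- The line through the origin of the torus in the direction `a`, at speed `1 / (2 π)`. -/
noncomputable def torusLine (a : Fin ℓ → ℤ) (θ : ℝ) : UnitAddTorus (Fin ℓ) :=
  fun i => ((θ / (2 * Real.pi) * a i : ℝ) : UnitAddCircle)

theorem continuous_torusLine (a : Fin ℓ → ℤ) : Continuous (torusLine a) := by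
  refine continuous_pi fun i => ?_
  exact (AddCircle.continuous_mk' (1 : ℝ)).comp (by fun_prop)

theorem mFourier_add_torusLine (j a : Fin ℓ → ℤ) (x : UnitAddTorus (Fin ℓ)) (θ : ℝ) :
    UnitAddTorus.mFourier j (x + torusLine a θ) =
      UnitAddTorus.mFourier j x * Complex.exp (θ * Complex.I * (∑ i, a i * j i : ℤ)) := by
  simp only [UnitAddTorus.mFourier, ContinuousMap.coe_mk, Pi.add_apply]
  have h : ∀ i, fourier (j i) (x i + torusLine a θ i) = fourier (j i) (x i) *
      Complex.exp (θ * Complex.I * (a i * j i : ℤ)) := by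
    intro i
    have h1 : fourier (j i) (x i + torusLine a θ i) =
        fourier (j i) (x i) * fourier (j i) (torusLine a θ i) := by
      simp [fourier_apply, smul_add, AddCircle.toCircle_add]
    rw [h1]
    congr 1
    rw [torusLine, fourier_coe_apply]
    congr 1
    have := Real.pi_ne_zero
    push_cast
    field_simp
  simp only [h]
  rw [Finset.prod_mul_distrib, ← Complex.exp_sum, Int.cast_sum, Finset.mul_sum]

/-- The restriction of a Laurent polynomial to a line on the torus, as a polynomial in one variable
whose exponents are given by `e`. -/
noncomputable def lineRestriction (F : MvLaurentPolynomial ℓ) (e : (Fin ℓ → ℤ) → ℕ)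
    (x : UnitAddTorus (Fin ℓ)) : ℂ[X] :=
  ∑ j ∈ F.coeff.support, Polynomial.monomial (e j) (F.coeff j * UnitAddTorus.mFourier j x)

theorem card_support_lineRestriction_le (F : MvLaurentPolynomial ℓ) (e : (Fin ℓ → ℤ) → ℕ)
    (x : UnitAddTorus (Fin ℓ)) :
    (F.lineRestriction e x).support.card ≤ F.coeff.support.card := by
  classical
  refine (Finset.card_le_card ?_).trans (Finset.card_image_le (f := e))
  intro n hn
  by_contra hmem
  refine mem_support_iff.mp hn ?_
  rw [lineRestriction, finsetSum_coeff]
  refine Finset.sum_eq_zero fun j hj => ?_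
  rw [coeff_monomial, if_neg]
  rintro rfl
  exact hmem (Finset.mem_image_of_mem e hj)

theorem norm_coeff_lineRestriction (F : MvLaurentPolynomial ℓ) {e : (Fin ℓ → ℤ) → ℕ}
    (he : Set.InjOn e F.coeff.support) (x : UnitAddTorus (Fin ℓ)) {j : Fin ℓ → ℤ}
    (hj : j ∈ F.coeff.support) : ‖(F.lineRestriction e x).coeff (e j)‖ = ‖F.coeff j‖ := by
  rw [lineRestriction, finsetSum_coeff, Finset.sum_eq_single_of_mem j hj, coeff_monomial,
    if_pos rfl, norm_mul, norm_mFourier_apply, mul_one]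
  intro b hb hne
  rw [coeff_monomial, if_neg fun h => hne (he hb hj h)]

theorem norm_torusEval_add_torusLine (F : MvLaurentPolynomial ℓ) {e : (Fin ℓ → ℤ) → ℕ}
    {a : Fin ℓ → ℤ} {N : ℤ} (he : ∀ j ∈ F.coeff.support, (e j : ℤ) = ∑ i, a i * j i + N)
    (x : UnitAddTorus (Fin ℓ)) (θ : ℝ) :
    ‖F.torusEval (x + torusLine a θ)‖ = ‖(F.lineRestriction e x).eval (circleMap 0 1 θ)‖ := by
  have h : (F.lineRestriction e x).eval (circleMap 0 1 θ) =
      Complex.exp ((θ * N : ℝ) * Complex.I) * F.torusEval (x + torusLine a θ) := by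
    rw [lineRestriction, eval_finsetSum, torusEval, Finset.mul_sum]
    refine Finset.sum_congr rfl fun j hj => ?_
    rw [eval_monomial, mFourier_add_torusLine]
    have h1 : circleMap 0 1 θ ^ e j = Complex.exp ((θ * N : ℝ) * Complex.I) *
        Complex.exp (θ * Complex.I * (∑ i, a i * j i : ℤ)) := by
      rw [← Complex.exp_add, circleMap, zero_add, Complex.ofReal_one, one_mul,
        ← Complex.exp_nat_mul]
      congr 1
      have h2 : ((e j : ℕ) : ℂ) = ((∑ i, a i * j i + N : ℤ) : ℂ) := by
        rw [← he j hj, Int.cast_natCast]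
      rw [h2]
      push_cast
      ring
    rw [h1]
    ring
  rw [h, norm_mul, Complex.norm_exp_ofReal_mul_I, one_mul]

theorem exists_exponents (F : MvLaurentPolynomial ℓ) :
    ∃ (e : (Fin ℓ → ℤ) → ℕ) (a : Fin ℓ → ℤ) (N : ℤ), Set.InjOn e F.coeff.support ∧
      ∀ j ∈ F.coeff.support, (e j : ℤ) = ∑ i, a i * j i + N := by
  obtain ⟨a, ha⟩ := exists_injOn_sum_mul F.coeff.support
  -- The shift by N makes all exponents nonnegative.
  set N : ℤ := ∑ j ∈ F.coeff.support, |∑ i, a i * j i| with hN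
  have he : ∀ j ∈ F.coeff.support,
      ((∑ i, a i * j i + N).toNat : ℤ) = ∑ i, a i * j i + N := by
    intro j hj
    refine Int.toNat_of_nonneg ?_
    have h1 : |∑ i, a i * j i| ≤ N :=
      Finset.single_le_sum (f := fun j : Fin ℓ → ℤ => |∑ i, a i * j i|)
        (fun _ _ => abs_nonneg _) hj
    have h2 := neg_abs_le (∑ i, a i * j i)
    linarith
  refine ⟨fun j => (∑ i, a i * j i + N).toNat, a, N, fun x hx y hy hxy => ha hx hy ?_, he⟩
  have h1 := he x hx
  have h2 := he y hy
  simp only at hxy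
  rw [hxy, h2] at h1
  simpa using h1.symm

/-! ### Averaging over lines and transfer to the unit cube -/

/-- Averaging over the translates along a line does not change integrals over the torus. -/
theorem lintegral_torus_eq_lintegral_lintegral_torusLine (a : Fin ℓ → ℤ)
    {f : UnitAddTorus (Fin ℓ) → ENNReal} (hf : Measurable f) :
    ENNReal.ofReal (2 * Real.pi) * ∫⁻ x, f x =
      ∫⁻ x, ∫⁻ θ in Set.Ioc 0 (2 * Real.pi), f (x + torusLine a θ) := by
  rw [lintegral_lintegral_swap]
  -- For fixed θ, translation preserves the measure on the torus.
  · simp_rw [lintegral_add_right_eq_self f]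
    simp [mul_comm]
  · refine Measurable.aemeasurable (hf.comp ?_)
    exact measurable_fst.add ((continuous_torusLine a).measurable.comp measurable_snd)

theorem lintegral_torus_le {F : MvLaurentPolynomial ℓ} {k : ℕ} (hk : F.coeff.support.card ≤ k + 2)
    {j : Fin ℓ → ℤ} (hj : j ∈ F.coeff.support) {b : ℝ}
    (hb : ∀ x, Real.log ‖F.torusEval x‖ ≤ b) :
    ∫⁻ x, ENNReal.ofReal (b - Real.log ‖F.torusEval x‖) ≤
      ENNReal.ofReal (b - Real.log (‖F.coeff j‖ / 2 ^ k)) := by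
  obtain ⟨e, a, N, he, hea⟩ := F.exists_exponents
  have hpi : (0 : ℝ) < 2 * Real.pi := by positivity
  have hmeas : Measurable fun x => ENNReal.ofReal (b - Real.log ‖F.torusEval x‖) :=
    (measurable_const.sub
      (Real.measurable_log.comp F.continuous_torusEval.norm.measurable)).ennreal_ofReal
  have hinner : ∀ x, ∫⁻ θ in Set.Ioc 0 (2 * Real.pi),
      ENNReal.ofReal (b - Real.log ‖F.torusEval (x + torusLine a θ)‖) ≤
        ENNReal.ofReal (2 * Real.pi * (b - Real.log (‖F.coeff j‖ / 2 ^ k))) := by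
    intro x
    set p := F.lineRestriction e x with hp
    have hline : ∀ θ, ‖F.torusEval (x + torusLine a θ)‖ = ‖p.eval (circleMap 0 1 θ)‖ :=
      F.norm_torusEval_add_torusLine hea x
    have hint := p.intervalIntegrable_mahlerMeasure
    have hint' : IntervalIntegrable (fun θ => b - Real.log ‖p.eval (circleMap 0 1 θ)‖)
        volume 0 (2 * Real.pi) := intervalIntegrable_const.sub hint
    have hnonneg : ∀ θ, 0 ≤ b - Real.log ‖p.eval (circleMap 0 1 θ)‖ := by
      intro θ
      rw [← hline θ]
      exact sub_nonneg.mpr (hb _)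
    simp_rw [hline]
    rw [← ofReal_integral_eq_lintegral_ofReal
      ((intervalIntegrable_iff_integrableOn_Ioc_of_le hpi.le).mp hint')
      (Filter.Eventually.of_forall hnonneg), ← intervalIntegral.integral_of_le hpi.le,
      intervalIntegral.integral_sub intervalIntegrable_const hint, intervalIntegral.integral_const,
      sub_zero, smul_eq_mul]
    have hcj : 0 < ‖F.coeff j‖ := norm_pos_iff.mpr (Finsupp.mem_support_iff.mp hj)
    have hcoeff := norm_coeff_le_two_pow_mul_mahlerMeasure k p
      ((F.card_support_lineRestriction_le e x).trans hk) (e j)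
    rw [F.norm_coeff_lineRestriction he x hj] at hcoeff
    have hp0 : p ≠ 0 := by
      intro h0
      have := F.norm_coeff_lineRestriction he x hj
      rw [← hp, h0, coeff_zero, norm_zero] at this
      exact hcj.ne this
    have hlog : Real.log (‖F.coeff j‖ / 2 ^ k) ≤ Real.log p.mahlerMeasure := by
      refine Real.log_le_log (by positivity) ?_
      rw [div_le_iff₀ (by positivity)]
      linarith
    rw [mahlerMeasure_def_of_ne_zero hp0, Real.log_exp, inv_mul_eq_div, le_div_iff₀ hpi] at hlog
    refine ENNReal.ofReal_le_ofReal ?_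
    linarith
  have h := lintegral_torus_eq_lintegral_lintegral_torusLine a hmeas
  have hle : ENNReal.ofReal (2 * Real.pi) *
      ∫⁻ x, ENNReal.ofReal (b - Real.log ‖F.torusEval x‖) ≤ ENNReal.ofReal (2 * Real.pi) *
      ENNReal.ofReal (b - Real.log (‖F.coeff j‖ / 2 ^ k)) := by
    rw [h, ← ENNReal.ofReal_mul hpi.le]
    refine (lintegral_mono hinner).trans ?_
    have huniv : (volume : Measure (UnitAddTorus (Fin ℓ))) Set.univ = 1 := by
      rw [volume_pi, Measure.pi_univ]
      simp
    simp [huniv]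
  exact (ENNReal.mul_le_mul_iff_right (by simpa using Real.pi_pos) ENNReal.ofReal_ne_top).mp hle

theorem exists_log_norm_torusEval_le (F : MvLaurentPolynomial ℓ) :
    ∃ b : ℝ, ∀ x, Real.log ‖F.torusEval x‖ ≤ b := by
  obtain ⟨B, hB⟩ := (isCompact_range F.continuous_torusEval.norm).bddAbove
  refine ⟨B, fun x => ?_⟩
  exact (Real.log_le_self (norm_nonneg _)).trans (hB ⟨x, rfl⟩)

/-- Integrability on the torus of `log |F|`, with the lower bound for its integral. -/
theorem integrable_log_norm_torusEval {F : MvLaurentPolynomial ℓ} {k : ℕ}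
    (hk : F.coeff.support.card ≤ k + 2) {j : Fin ℓ → ℤ} (hj : j ∈ F.coeff.support) :
    Integrable (fun x => Real.log ‖F.torusEval x‖) ∧
      Real.log (‖F.coeff j‖ / 2 ^ k) ≤ ∫ x, Real.log ‖F.torusEval x‖ := by
  -- The bound b is enlarged so that `ENNReal.ofReal` does not truncate the right-hand side of
  -- `lintegral_torus_le`.
  obtain ⟨b, hb, hbK⟩ : ∃ b : ℝ, (∀ x, Real.log ‖F.torusEval x‖ ≤ b) ∧
      Real.log (‖F.coeff j‖ / 2 ^ k) ≤ b := by
    obtain ⟨b, hb⟩ := F.exists_log_norm_torusEval_le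
    exact ⟨max b _, fun x => (hb x).trans (le_max_left _ _), le_max_right _ _⟩
  have : IsProbabilityMeasure (volume : Measure (UnitAddTorus (Fin ℓ))) :=
    ⟨by rw [volume_pi, Measure.pi_univ]; simp⟩
  have hle := lintegral_torus_le hk hj hb
  have hmeas : Measurable fun x => b - Real.log ‖F.torusEval x‖ :=
    measurable_const.sub (Real.measurable_log.comp F.continuous_torusEval.norm.measurable)
  have hnonneg : 0 ≤ᵐ[volume] fun x => b - Real.log ‖F.torusEval x‖ :=
    Filter.Eventually.of_forall fun x => sub_nonneg.mpr (hb x)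
  have hint : Integrable fun x => b - Real.log ‖F.torusEval x‖ :=
    (lintegral_ofReal_ne_top_iff_integrable hmeas.aestronglyMeasurable hnonneg).mp
      (hle.trans_lt ENNReal.ofReal_lt_top).ne
  have hlog : Integrable fun x => Real.log ‖F.torusEval x‖ := by
    refine ((integrable_const b).sub hint).congr (Filter.Eventually.of_forall fun x => ?_)
    simp
  refine ⟨hlog, ?_⟩
  rw [← ofReal_integral_eq_lintegral_ofReal hint hnonneg, integral_sub (integrable_const b) hlog,
    integral_const, probReal_univ, one_smul] at hle
  have := (ENNReal.ofReal_le_ofReal_iff (sub_nonneg.mpr hbK)).mp hle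
  linarith

theorem measurePreserving_coe_torus :
    MeasurePreserving (fun (t : Fin ℓ → ℝ) i => (t i : UnitAddCircle))
      (volume.restrict (Set.Icc (0 : Fin ℓ → ℝ) 1)) volume := by
  have h : volume.restrict (Set.Icc (0 : Fin ℓ → ℝ) 1) =
      Measure.pi fun _ : Fin ℓ => (volume : Measure ℝ).restrict (Set.Ioc 0 1) := by
    rw [volume_pi, ← Measure.restrict_congr_set Measure.univ_pi_Ioc_ae_eq_Icc,
      Measure.restrict_pi_pi]
    rfl
  rw [h]
  refine measurePreserving_pi _ _ fun i => ?_
  simpa using UnitAddCircle.measurePreserving_mk 0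

theorem card_support_le {F : MvLaurentPolynomial ℓ} {k : ℕ} (hF : F.IsSumOfMonomials k) :
    F.coeff.support.card ≤ k := by
  classical
  obtain ⟨e, c, rfl⟩ := hF
  have hsub : (∑ i, monomial (e i) (c i)).coeff.support ⊆ Finset.univ.image e := by
    intro j hj
    by_contra hmem
    refine Finsupp.mem_support_iff.mp hj ?_
    rw [AddMonoidAlgebra.coeff_sum, Finsupp.finsetSum_apply]
    refine Finset.sum_eq_zero fun i _ => ?_
    rw [monomial, AddMonoidAlgebra.coeff_single, Finsupp.single_apply, if_neg]
    rintro rfl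
    exact hmem (Finset.mem_image_of_mem e (Finset.mem_univ i))
  simpa using (Finset.card_le_card hsub).trans Finset.card_image_le

theorem exists_height_eq {F : MvLaurentPolynomial ℓ} (hF : F ≠ 0) :
    ∃ j ∈ F.coeff.support, F.height = ‖F.coeff j‖ := by
  have hne : F.coeff.support.Nonempty := by
    rw [Finsupp.support_nonempty_iff]
    intro h
    exact hF (AddMonoidAlgebra.coeff_injective h)
  obtain ⟨j, hj, h⟩ := Finset.exists_mem_eq_sup _ hne fun j => ‖F.coeff j‖₊
  exact ⟨j, hj, by rw [height, h, coe_nnnorm]⟩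

end MvLaurentPolynomial

open MvLaurentPolynomial in
/-- The defining integral of `m(F)` converges absolutely, and `M(F) ≥ h(F) / 2^{k-2}`. -/
theorem corollary2 (ℓ : ℕ) (hℓ : 1 ≤ ℓ) (k : ℕ) (hk : 2 ≤ k) (F : MvLaurentPolynomial ℓ)
    (hF : F ≠ 0) (hFk : F.IsSumOfMonomials k) :
    MeasureTheory.IntegrableOn F.logNormOnTorus (Set.Icc (0 : Fin ℓ → ℝ) 1) ∧
      F.mahlerMeasure ≥ F.height / 2 ^ (k - 2) := by
  obtain ⟨j, hj, hheight⟩ := exists_height_eq hF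
  have hcard : F.coeff.support.card ≤ k - 2 + 2 := by
    have := card_support_le hFk
    omega
  obtain ⟨hint, hle⟩ := integrable_log_norm_torusEval hcard hj
  have hcj : 0 < ‖F.coeff j‖ := norm_pos_iff.mpr (Finsupp.mem_support_iff.mp hj)
  have hmp := measurePreserving_coe_torus (ℓ := ℓ)
  have hfun : F.logNormOnTorus = (fun x => Real.log ‖F.torusEval x‖) ∘
      fun (t : Fin ℓ → ℝ) i => (t i : UnitAddCircle) := funext F.logNormOnTorus_eq
  refine ⟨?_, ?_⟩
  · rw [MeasureTheory.IntegrableOn, hfun]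
    exact hmp.integrable_comp_of_integrable hint
  · have hm : F.logMahlerMeasure = ∫ x, Real.log ‖F.torusEval x‖ := by
      rw [logMahlerMeasure, hfun, ← hmp.map_eq, MeasureTheory.integral_map hmp.aemeasurable]
      · rfl
      · rw [hmp.map_eq]
        exact hint.aestronglyMeasurable
    rw [ge_iff_le, mahlerMeasure, hm, hheight]
    exact (Real.log_le_iff_le_exp (by positivity)).mp hle
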